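/- Let $\tau>0$ and let $H$ be a probability distribution on $\mathbb{R}$ with a continuous, everywhere positive density. For data $X_1,X_2,\dots$ i.i.d. $N(\theta,1)$ under $\mathbb{P}_\theta$, with $S_t=\sum_{i=1}^t X_i$, let $$\Lambda_t^H(s)=\int_{\mathbb{R}} e^{\theta s-t\theta^2/2}\,dH(\theta)$$ be the mixture likelihood ratio against $H_0:\theta=0$, and let $$T=T(\alpha)=\inf\{t\ge 1:\Lambda_t^H(S_t)\ge\alpha^{-1}\}\in\mathbb{N}\cup\{\infty\}$$ be the time at which the mixture sequential probability ratio test (mSPRT) with mixing distribution $H$ first rejects $H_0$ at level $\alpha\in(0,1)$. Let $\alpha\to 0$ and $n\to\infty$ ($n\in\mathbb{N}$) in such a way that $\log(\alpha^{-1})/n\to 0$, with $\tau$ and $H$ fixed. Then $$\mathbb{E}_{\theta\sim N(0,\tau)}\,\mathbb{E}_\theta\,(T(\alpha)\wedge n)=o(n),$$ where $N(0,\tau)$ is the centred normal distribution with standard deviation $\tau$. -/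

import Mathlib

open MeasureTheory ProbabilityTheory Filter Topology Asymptotics
open scoped ENNReal NNReal

/-- The law of an i.i.d. sequence of `N(θ, 1)` observations, on the space of sample paths. The
observations `X₁, X₂, …` are the coordinates `x 0, x 1, …`. -/
noncomputable def dataLaw (θ : ℝ) : Measure (ℕ → ℝ) :=
  Measure.infinitePi (fun _ : ℕ => gaussianReal θ 1)

/-- The partial sum `S_t = X₁ + ⋯ + X_t`. -/
def partialSum (t : ℕ) (x : ℕ → ℝ) : ℝ := ∑ i ∈ Finset.range t, x i

/-- The mixture likelihood ratio `Λ_t^H(s)`, for `N(θ, 1)` data, of the mixing distribution `H`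
against `θ = 0`, as a function of the value `s` of the sufficient statistic `S_t`. -/
noncomputable def mixtureLR (H : Measure ℝ) (t : ℕ) (s : ℝ) : ℝ :=
  ∫ θ, Real.exp (θ * s - t * (θ ^ 2 / 2)) ∂H

/-- `Λ_t^H(S_t)` is the `H`-mixture of the likelihood ratios `∏ f_θ(X_i) / f_0(X_i)`. -/
theorem mixtureLR_partialSum (H : Measure ℝ) (t : ℕ) (x : ℕ → ℝ) :
    mixtureLR H t (partialSum t x) =
      ∫ θ, (∏ i ∈ Finset.range t, gaussianPDFReal θ 1 (x i) / gaussianPDFReal 0 1 (x i)) ∂H := by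
  unfold mixtureLR partialSum
  congr 1
  funext θ
  have h : ∀ y : ℝ, gaussianPDFReal θ 1 y / gaussianPDFReal 0 1 y
      = Real.exp (θ * y - θ ^ 2 / 2) := by
    intro y
    have hc : (√(2 * Real.pi * ((1 : ℝ≥0) : ℝ)))⁻¹ ≠ 0 := by
      have := Real.pi_pos
      simp only [NNReal.coe_one]
      positivity
    unfold gaussianPDFReal
    rw [mul_div_mul_left _ _ hc, ← Real.exp_sub]
    congr 1
    simp only [NNReal.coe_one]
    ring
  simp only [h]
  rw [← Real.exp_sum, Finset.sum_sub_distrib, ← Finset.mul_sum]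
  simp

/-- The first time `T(α) = inf {t ≥ 1 : Λ_t^H(S_t) ≥ α⁻¹}` at which the mSPRT with mixing
distribution `H` rejects `θ = 0` at level `α`; it is `⊤` if the test never rejects. -/
noncomputable def msprtTime (H : Measure ℝ) (α : ℝ) (x : ℕ → ℝ) : ℕ∞ :=
  ⨅ (t : ℕ) (_ : 1 ≤ t ∧ α⁻¹ ≤ mixtureLR H t (partialSum t x)), (t : ℕ∞)

/-- The expected run time `E_θ (T(α) ∧ n)` of the mSPRT truncated at `n`, under `N(θ, 1)` data. -/
noncomputable def expectedTruncatedTime (H : Measure ℝ) (α : ℝ) (n : ℕ) (θ : ℝ) : ℝ≥0∞ :=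
  ∫⁻ x, ((min (msprtTime H α x) (n : ℕ∞) : ℕ∞) : ℝ≥0∞) ∂(dataLaw θ)

/-- The expected run time of the mSPRT truncated at `n`, averaged over a prior `G` for `θ`. -/
noncomputable def averageTruncatedTime (G H : Measure ℝ) (α : ℝ) (n : ℕ) : ℝ≥0∞ :=
  ∫⁻ θ, expectedTruncatedTime H α n θ ∂G

/-- The average run time is at most `n`; in particular it is finite. -/
theorem averageTruncatedTime_le (G H : Measure ℝ) [IsProbabilityMeasure G] (α : ℝ) (n : ℕ) :
    averageTruncatedTime G H α n ≤ n := by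
  have h1 : ∀ θ, expectedTruncatedTime H α n θ ≤ n := by
    intro θ
    have hp : IsProbabilityMeasure (dataLaw θ) := by unfold dataLaw; infer_instance
    calc expectedTruncatedTime H α n θ ≤ ∫⁻ _, (n : ℝ≥0∞) ∂(dataLaw θ) := by
          refine lintegral_mono fun x => ?_
          have : (min (msprtTime H α x) (n : ℕ∞) : ℕ∞) ≤ (n : ℕ∞) := min_le_right _ _
          simpa using ENat.toENNReal_le.2 this
      _ = n := by simp
  calc averageTruncatedTime G H α n ≤ ∫⁻ _, (n : ℝ≥0∞) ∂G := lintegral_mono h1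
    _ = n := by simp

/-!
If `S_t / t` is within `δ` of `θ`, then the exponent `θ' S_t - t θ'² / 2` of the mixture likelihood
ratio is at least `t r² / 4` for all `θ'` within `δ` of `θ`, provided `8 δ ≤ r ≤ |θ|`. Hence
`Λ_t^H(S_t) ≥ H [θ - δ, θ + δ] exp (t r² / 4)` (`le_mixtureLR_of_near`), and the mass
`H [θ - δ, θ + δ]` is bounded below uniformly over compact sets of `θ`
(`exists_le_measureReal_closedBall`). As `log α⁻¹ = o(n)`, taking `t ≥ η n` makes this lower bound
exceed `α⁻¹`, however small `η > 0` is. By Chebyshev's inequality the event `|S_t - t θ| ≥ δ t` has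
probability at most `1 / (t δ²)`, so `E_θ (T ∧ n) ≤ t + n / (t δ²)`
(`expectedTruncatedTime_le`), uniformly over `θ` in a compact set that avoids `0`.

The prior has no atom at `0`, so such a compact set can be chosen to carry all but an arbitrarily
small part `ε` of its mass; the remaining `θ` contribute at most `ε n`, because `T ∧ n ≤ n`.
All estimates are uniform, so the argument applies along any filter.
-/

/-! ### Lower bounds for the mixture likelihood ratio -/

/-- Completing the square bounds the integrand by `exp (s² / (2 t))`. -/
theorem integrable_mixtureLR (H : Measure ℝ) [IsFiniteMeasure H] {t : ℕ} (ht : 1 ≤ t) (s : ℝ) :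
    Integrable (fun θ => Real.exp (θ * s - t * (θ ^ 2 / 2))) H := by
  have ht' : (0 : ℝ) < t := by exact_mod_cast ht
  refine Integrable.of_bound (C := Real.exp (s ^ 2 / (2 * t)))
    (by fun_prop : Continuous fun θ : ℝ =>
      Real.exp (θ * s - t * (θ ^ 2 / 2))).aestronglyMeasurable (ae_of_all _ fun θ => ?_)
  rw [Real.norm_of_nonneg (Real.exp_pos _).le]
  refine Real.exp_le_exp.2 ?_
  rw [le_div_iff₀ (by positivity)]
  nlinarith [sq_nonneg (s - t * θ)]

theorem measureReal_mul_exp_le_mixtureLR (H : Measure ℝ) [IsFiniteMeasure H] {t : ℕ}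
    (ht : 1 ≤ t) {s b : ℝ} {A : Set ℝ} (hA : MeasurableSet A)
    (hb : ∀ θ ∈ A, b ≤ θ * s - t * (θ ^ 2 / 2)) :
    H.real A * Real.exp b ≤ mixtureLR H t s := by
  have hint := integrable_mixtureLR H ht s
  calc H.real A * Real.exp b
      ≤ ∫ θ in A, Real.exp (θ * s - t * (θ ^ 2 / 2)) ∂H := by
        rw [mul_comm]
        exact setIntegral_ge_of_const_le_real hA (measure_ne_top _ _)
          (fun θ hθ => Real.exp_le_exp.2 (hb θ hθ)) hint.integrableOn
    _ ≤ mixtureLR H t s :=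
        setIntegral_le_integral hint (ae_of_all _ fun θ => (Real.exp_pos _).le)

/-- If `s / t` is close to a `θ` that is bounded away from `0`, then the mixture likelihood ratio is
exponentially large in `t`. -/
theorem le_mixtureLR_of_near (H : Measure ℝ) [IsFiniteMeasure H] {t : ℕ} (ht : 1 ≤ t)
    {r δ θ s : ℝ} (hδ : 0 ≤ δ) (hδr : 8 * δ ≤ r) (hr : r ≤ |θ|) (hs : |s - t * θ| ≤ δ * t) :
    H.real (Metric.closedBall θ δ) * Real.exp (t * (r ^ 2 / 4)) ≤ mixtureLR H t s := by
  refine measureReal_mul_exp_le_mixtureLR H ht measurableSet_closedBall fun θ' hθ' => ?_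
  have ht' : (0 : ℝ) < t := by exact_mod_cast ht
  rw [Metric.mem_closedBall, Real.dist_eq] at hθ'
  obtain ⟨m, rfl⟩ : ∃ m, s = t * m := ⟨s / t, by field_simp⟩
  have hm : |m - θ| ≤ δ := by
    rw [← mul_sub, abs_mul, abs_of_pos ht', mul_comm] at hs
    exact le_of_mul_le_mul_right hs ht'
  have hm' : 7 / 8 * r ≤ |m| := by
    have := abs_sub_abs_le_abs_sub θ m
    rw [abs_sub_comm] at this
    linarith
  have hmθ : |θ' - m| ≤ r / 4 := by
    have := abs_sub_le θ' θ m
    rw [abs_sub_comm θ m] at this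
    linarith
  have hr0 : 0 ≤ r := by linarith
  have h1 : (7 / 8 * r) ^ 2 ≤ m ^ 2 := by
    rw [← sq_abs m]
    gcongr
  have h2 : (θ' - m) ^ 2 ≤ (r / 4) ^ 2 := by
    rw [← sq_abs]
    gcongr
  have h3 : r ^ 2 / 4 ≤ θ' * m - θ' ^ 2 / 2 := by nlinarith
  calc (t : ℝ) * (r ^ 2 / 4) ≤ t * (θ' * m - θ' ^ 2 / 2) := by gcongr
    _ = _ := by ring

/-- A measure with a continuous positive density gives all balls of a fixed radius around the points
of a compact set at least a fixed positive mass. -/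
theorem exists_le_measureReal_closedBall {H : Measure ℝ} [IsFiniteMeasure H] {h : ℝ → ℝ}
    (hcont : Continuous h) (hpos : ∀ θ, 0 < h θ)
    (hH : H = volume.withDensity (fun θ => ENNReal.ofReal (h θ)))
    {K : Set ℝ} (hK : IsCompact K) {δ : ℝ} (hδ : 0 < δ) :
    ∃ c, 0 < c ∧ ∀ θ ∈ K, c ≤ H.real (Metric.closedBall θ δ) := by
  rcases (Metric.cthickening δ K).eq_empty_or_nonempty with he | hne
  · refine ⟨1, one_pos, fun θ hθ => ?_⟩
    have := Metric.self_subset_cthickening (δ := δ) K hθ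
    simp [he] at this
  obtain ⟨θ₀, -, hmin⟩ := hK.cthickening.exists_isMinOn hne hcont.continuousOn
  refine ⟨h θ₀ * (2 * δ), mul_pos (hpos _) (by positivity), fun θ hθ => ?_⟩
  rw [measureReal_def]
  refine (ENNReal.ofReal_le_iff_le_toReal (measure_ne_top _ _)).1 ?_
  calc ENNReal.ofReal (h θ₀ * (2 * δ))
      = ∫⁻ _ in Metric.closedBall θ δ, ENNReal.ofReal (h θ₀) := by
        rw [setLIntegral_const, Real.volume_closedBall, ENNReal.ofReal_mul (hpos _).le]
    _ ≤ ∫⁻ θ' in Metric.closedBall θ δ, ENNReal.ofReal (h θ') := by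
        refine setLIntegral_mono (by fun_prop) fun θ' hθ' => ENNReal.ofReal_le_ofReal ?_
        exact hmin (Metric.closedBall_subset_cthickening hθ δ hθ')
    _ = H (Metric.closedBall θ δ) := by
        rw [hH, withDensity_apply _ measurableSet_closedBall]

/-! ### Deviations of the partial sums -/

instance isProbabilityMeasure_dataLaw (θ : ℝ) : IsProbabilityMeasure (dataLaw θ) := by
  unfold dataLaw
  infer_instance

/-- Chebyshev's inequality for the partial sums of i.i.d. `N(θ, 1)` observations. -/
theorem dataLaw_partialSum_deviation_le (θ : ℝ) {t : ℕ} (ht : 1 ≤ t) {δ : ℝ} (hδ : 0 < δ) :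
    dataLaw θ {x | δ * t ≤ |partialSum t x - t * θ|} ≤ ENNReal.ofReal (1 / (t * δ ^ 2)) := by
  have ht' : (0 : ℝ) < t := by exact_mod_cast ht
  let X : ℕ → (ℕ → ℝ) → ℝ := fun i x => x i
  have hlaw (i : ℕ) : MeasurePreserving (X i) (dataLaw θ) (gaussianReal θ 1) :=
    measurePreserving_eval_infinitePi (fun _ : ℕ => gaussianReal θ 1) i
  have hL (i : ℕ) : MemLp (X i) 2 (dataLaw θ) :=
    (memLp_id_gaussianReal (μ := θ) (v := 1) 2).comp_measurePreserving (hlaw i)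
  have hmean (i : ℕ) : ∫ x, X i x ∂(dataLaw θ) = θ := by
    have := integral_id_gaussianReal (μ := θ) (v := 1)
    rwa [← (hlaw i).map_eq,
      integral_map (hlaw i).measurable.aemeasurable (by fun_prop)] at this
  have hvar (i : ℕ) : Var[X i; dataLaw θ] = 1 := by
    have := variance_id_gaussianReal (μ := θ) (v := 1)
    rw [← (hlaw i).map_eq, variance_map aemeasurable_id (hlaw i).measurable.aemeasurable] at this
    simpa using this
  have hind : iIndepFun X (dataLaw θ) :=
    iIndepFun_infinitePi (P := fun _ : ℕ => gaussianReal θ 1) (X := fun _ y => y)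
      (fun _ => measurable_id)
  have hsum : partialSum t = ∑ i ∈ Finset.range t, X i := by
    ext x
    simp [partialSum, X]
  have hSvar : Var[partialSum t; dataLaw θ] = t := by
    rw [hsum, IndepFun.variance_sum (fun i _ => hL i)
      (fun i _ j _ hij => hind.indepFun hij)]
    simp [hvar]
  have hSmean : ∫ x, partialSum t x ∂(dataLaw θ) = t * θ := by
    have : ∀ x, partialSum t x = ∑ i ∈ Finset.range t, X i x := fun _ => rfl
    simp_rw [this]
    rw [integral_finsetSum _ fun i _ => (hL i).integrable one_le_two]
    simp [hmean]
  have hSL : MemLp (partialSum t) 2 (dataLaw θ) := by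
    rw [hsum]
    exact memLp_finsetSum' _ fun i _ => hL i
  have := meas_ge_le_variance_div_sq hSL (c := δ * t) (by positivity)
  rw [hSmean, hSvar] at this
  convert this using 2
  field_simp

/-! ### Bounds for the truncated run time -/

theorem min_msprtTime_le (H : Measure ℝ) (α : ℝ) (n : ℕ) (x : ℕ → ℝ) :
    ((min (msprtTime H α x) (n : ℕ∞) : ℕ∞) : ℝ≥0∞) ≤ n := by
  simp

theorem min_msprtTime_le_of_reject {H : Measure ℝ} {α : ℝ} (n : ℕ) {x : ℕ → ℝ} {t : ℕ}
    (ht : 1 ≤ t) (hx : α⁻¹ ≤ mixtureLR H t (partialSum t x)) :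
    ((min (msprtTime H α x) (n : ℕ∞) : ℕ∞) : ℝ≥0∞) ≤ t := by
  have h : min (msprtTime H α x) (n : ℕ∞) ≤ (t : ℕ∞) :=
    (min_le_left _ _).trans (iInf₂_le t ⟨ht, hx⟩)
  simpa using ENat.toENNReal_le.2 h

theorem expectedTruncatedTime_le_natCast (H : Measure ℝ) (α : ℝ) (n : ℕ) (θ : ℝ) :
    expectedTruncatedTime H α n θ ≤ n :=
  (lintegral_mono fun x => min_msprtTime_le H α n x).trans (by simp)

/-- If the test rejects at time `t` whenever `S_t` is within `δ t` of its mean `t θ`, then the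
truncated run time exceeds `t` only on an event of probability at most `1 / (t δ²)`. -/
theorem expectedTruncatedTime_le {H : Measure ℝ} {α : ℝ} (n : ℕ) {θ δ : ℝ} {t : ℕ}
    (ht : 1 ≤ t) (hδ : 0 < δ) (hrej : ∀ s, |s - t * θ| ≤ δ * t → α⁻¹ ≤ mixtureLR H t s) :
    expectedTruncatedTime H α n θ ≤ t + n * ENNReal.ofReal (1 / (t * δ ^ 2)) := by
  set B : Set (ℕ → ℝ) := {x | δ * t ≤ |partialSum t x - t * θ|}
  have hmeas : MeasurableSet B := by
    have : Measurable (partialSum t) := by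
      unfold partialSum
      fun_prop
    exact measurableSet_le measurable_const (by fun_prop)
  calc expectedTruncatedTime H α n θ
      ≤ ∫⁻ x, (t + B.indicator (fun _ => (n : ℝ≥0∞)) x) ∂(dataLaw θ) := by
        refine lintegral_mono fun x => ?_
        by_cases hx : x ∈ B
        · rw [Set.indicator_of_mem hx]
          exact (min_msprtTime_le H α n x).trans le_add_self
        · have hx' : |partialSum t x - t * θ| ≤ δ * t := (not_le.1 hx).le
          exact (min_msprtTime_le_of_reject n ht (hrej _ hx')).trans le_self_add
    _ = t + n * dataLaw θ B := by
        rw [lintegral_add_left measurable_const, lintegral_indicator_const hmeas]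
        simp
    _ ≤ t + n * ENNReal.ofReal (1 / (t * δ ^ 2)) := by
        gcongr
        exact dataLaw_partialSum_deviation_le θ ht hδ

theorem averageTruncatedTime_le_of_forall_mem {G H : Measure ℝ} [IsProbabilityMeasure G] {α : ℝ}
    {n : ℕ} {K : Set ℝ} (hK : MeasurableSet K) {b : ℝ≥0∞}
    (hb : ∀ θ ∈ K, expectedTruncatedTime H α n θ ≤ b) :
    averageTruncatedTime G H α n ≤ b + n * G Kᶜ := by
  calc averageTruncatedTime G H α n
      ≤ ∫⁻ θ, (b + Kᶜ.indicator (fun _ => (n : ℝ≥0∞)) θ) ∂G := by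
        refine lintegral_mono fun θ => ?_
        by_cases hθ : θ ∈ K
        · exact (hb θ hθ).trans le_self_add
        · rw [Set.indicator_of_mem (Set.mem_compl hθ)]
          exact (expectedTruncatedTime_le_natCast H α n θ).trans le_add_self
    _ = b + n * G Kᶜ := by
        rw [lintegral_add_left measurable_const, lintegral_indicator_const hK.compl]
        simp

/-! ### Asymptotics of the average run time -/

/-- A probability measure without an atom at `0` is carried, up to a mass `ε`, by a compact set that
is bounded away from `0`. -/
theorem exists_isCompact_measure_compl_le (G : Measure ℝ) [IsProbabilityMeasure G] (hG : G {0} = 0)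
    {ε : ℝ≥0∞} (hε : ε ≠ 0) :
    ∃ K : Set ℝ, IsCompact K ∧ (∃ r, 0 < r ∧ ∀ θ ∈ K, r ≤ |θ|) ∧ G Kᶜ ≤ ε := by
  have h1 : G {0}ᶜ = 1 := (prob_compl_eq_one_iff (measurableSet_singleton 0)).2 hG
  obtain ⟨K, hsub, hK, hlt⟩ := (isOpen_compl_singleton (x := (0 : ℝ))).exists_lt_isCompact
    (μ := G) (r := 1 - ε) (by rw [h1]; exact ENNReal.sub_lt_self (by simp) (by simp) hε)
  refine ⟨K, hK, ?_, ?_⟩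
  · have h0 : (0 : ℝ) ∈ Kᶜ := fun h => hsub h rfl
    obtain ⟨r, hr, hball⟩ := Metric.isOpen_iff.1 hK.isClosed.isOpen_compl 0 h0
    refine ⟨r, hr, fun θ hθ => ?_⟩
    by_contra! hlt
    exact hball (by simpa using hlt) hθ
  · rw [prob_compl_eq_one_sub hK.measurableSet]
    exact tsub_le_iff_tsub_le.1 hlt.le

/-- The average truncated run time is `o(n)` for every prior without an atom at `0`. -/
theorem averageTruncatedTime_isLittleO (G : Measure ℝ) [IsProbabilityMeasure G] (hG : G {0} = 0)
    (H : Measure ℝ) [IsProbabilityMeasure H] (h : ℝ → ℝ) (hcont : Continuous h)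
    (hpos : ∀ θ, 0 < h θ) (hH : H = volume.withDensity (fun θ => ENNReal.ofReal (h θ)))
    {ι : Type*} (l : Filter ι) (α : ι → ℝ) (n : ι → ℕ)
    (hα : ∀ᶠ k in l, 0 < α k) (hn : Tendsto n l atTop)
    (hαn : Tendsto (fun k => Real.log (α k)⁻¹ / (n k : ℝ)) l (𝓝 0)) :
    (fun k => (averageTruncatedTime G H (α k) (n k)).toReal) =o[l] (fun k => (n k : ℝ)) := by
  refine isLittleO_iff.2 fun c hc => ?_
  obtain ⟨K, hK, ⟨r, hr, hrK⟩, hGK⟩ := exists_isCompact_measure_compl_le G hG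
    (ε := ENNReal.ofReal (c / 4)) (by simpa using hc)
  -- The rejection time is compared with `t = ⌈η n⌉`, where `η = c / 4`.
  set η := c / 4 with hηdef
  have hη : 0 < η := by positivity
  set δ := r / 8 with hδdef
  have hδ : 0 < δ := by positivity
  obtain ⟨m, hm, hmK⟩ := exists_le_measureReal_closedBall hcont hpos hH hK hδ
  have hnR : Tendsto (fun k => (n k : ℝ)) l atTop := tendsto_natCast_atTop_atTop.comp hn
  have hlog : ∀ᶠ k in l, Real.log (α k)⁻¹ / (n k : ℝ) < η * r ^ 2 / 8 :=
    hαn.eventually_lt_const (by positivity)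
  filter_upwards [hα, hlog, hnR.eventually_gt_atTop 0, hnR.eventually_ge_atTop (1 / η),
    hnR.eventually_ge_atTop (1 / (η * δ ^ 2) / η),
    hnR.eventually_ge_atTop (-Real.log m / (η * r ^ 2 / 8))]
    with k hαk hlogk hnk hn1 hn2 hn3
  set N := n k
  set t := ⌈η * (N : ℝ)⌉₊
  have htge : η * N ≤ t := Nat.le_ceil _
  have htle : (t : ℝ) ≤ η * N + 1 := (Nat.ceil_lt_add_one (by positivity)).le
  have ht : 1 ≤ t := Nat.one_le_ceil_iff.2 (by positivity)
  have ht' : (0 : ℝ) < t := by exact_mod_cast ht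
  have hthreshold : (α k)⁻¹ ≤ m * Real.exp (t * (r ^ 2 / 4)) := by
    rw [← Real.log_le_log_iff (inv_pos.2 hαk) (by positivity),
      Real.log_mul hm.ne' (Real.exp_pos _).ne', Real.log_exp]
    rw [div_lt_iff₀ hnk] at hlogk
    rw [div_le_iff₀ (by positivity)] at hn3
    nlinarith [mul_le_mul_of_nonneg_right htge (show 0 ≤ r ^ 2 / 4 by positivity)]
  have hbound := averageTruncatedTime_le_of_forall_mem (G := G) (H := H) (α := α k) (n := N)
    hK.measurableSet fun θ hθ => expectedTruncatedTime_le N ht hδ fun s hs =>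
      hthreshold.trans <| (mul_le_mul_of_nonneg_right (hmK θ hθ) (Real.exp_pos _).le).trans <|
        le_mixtureLR_of_near H ht hδ.le (by rw [hδdef]; linarith) (hrK θ hθ) hs
  have hcalc : averageTruncatedTime G H (α k) N ≤ ENNReal.ofReal (c * N) := by
    calc averageTruncatedTime G H (α k) N
        ≤ t + N * ENNReal.ofReal (1 / (t * δ ^ 2)) + N * ENNReal.ofReal η :=
          hbound.trans (by gcongr)
      _ = ENNReal.ofReal (t + N * (1 / (t * δ ^ 2)) + N * η) := by
          rw [ENNReal.ofReal_add (by positivity) (by positivity),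
            ENNReal.ofReal_add (by positivity) (by positivity),
            ENNReal.ofReal_mul (by positivity), ENNReal.ofReal_mul (by positivity)]
          simp
      _ ≤ ENNReal.ofReal (c * N) := by
          refine ENNReal.ofReal_le_ofReal ?_
          have hdev : N * (1 / (t * δ ^ 2)) ≤ η * N := by
            calc (N : ℝ) * (1 / (t * δ ^ 2)) ≤ N * (1 / (η * N * δ ^ 2)) := by gcongr
              _ = 1 / (η * δ ^ 2) := by field_simp
              _ ≤ η * N := by
                rw [div_le_iff₀ hη] at hn2
                linarith
          have h1 : 1 ≤ η * N := by
            rw [div_le_iff₀ hη] at hn1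
            linarith
          have hc4 : c = 4 * η := by rw [hηdef]; ring
          rw [hc4]
          linarith
  rw [Real.norm_of_nonneg ENNReal.toReal_nonneg, Real.norm_of_nonneg (Nat.cast_nonneg _)]
  exact ENNReal.toReal_le_of_le_ofReal (by positivity) hcalc

theorem mainTheorem2
    -- the prior `N(0, τ)`, with standard deviation `τ`
    (τ : ℝ≥0) (hτ : 0 < τ)
    -- the mixing distribution, a probability measure with a continuous, positive density on `ℝ`
    (H : Measure ℝ) [IsProbabilityMeasure H] (h : ℝ → ℝ) (hcont : Continuous h)
    (hpos : ∀ θ, 0 < h θ) (hH : H = volume.withDensity (fun θ => ENNReal.ofReal (h θ)))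
    -- the asymptotic regime, along an arbitrary sequence or net
    {ι : Type*} (l : Filter ι) (α : ι → ℝ) (n : ι → ℕ)
    (hα : Tendsto α l (𝓝[>] 0)) (hn : Tendsto n l atTop)
    (hαn : Tendsto (fun k => Real.log (α k)⁻¹ / (n k : ℝ)) l (𝓝 0)) :
    (fun k => (averageTruncatedTime (gaussianReal 0 (τ ^ 2)) H (α k) (n k)).toReal)
      =o[l] (fun k => (n k : ℝ)) := by
  have : NullSingletonClass (gaussianReal 0 (τ ^ 2)) :=
    nullSingletonClass_gaussianReal (pow_pos hτ 2).ne'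
  exact averageTruncatedTime_isLittleO _ (measure_singleton 0) H h hcont hpos hH l α n
    (hα.eventually self_mem_nhdsWithin) hn hαn
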